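/- For all integers $k \geq 1$ and $n \geq 4k$, the Kneser graph $K(n,k)$ is Hamiltonian, that is, it contains a cycle passing through every vertex exactly once. Here $K(n,k)$ is the graph whose vertices are the $k$-element subsets of $[n]=\{1,\dots,n\}$, with two distinct vertices adjacent if and only if they are disjoint as sets. -/

import Mathlib

/-- The Kneser graph `K(n, k)`: its vertices are the `k`-element subsets of an `n`-element
set (here `Fin n`), and two distinct vertices are adjacent if and only if they are disjoint
as sets. For `k ≥ 1` the distinctness is automatic for disjoint sets. -/
def kneserGraph (n k : ℕ) : SimpleGraph {s : Finset (Fin n) // s.card = k} where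
  Adj x y := x ≠ y ∧ Disjoint (x : Finset (Fin n)) (y : Finset (Fin n))
  symm := ⟨fun _ _ h => ⟨h.1.symm, h.2.symm⟩⟩
  loopless := ⟨fun _ h => h.1 rfl⟩

/-!
The Kneser graph `K(n, k)` with `n ≥ 4k` is Hamiltonian, by combining Baranyai's theorem with a
Gray code.

By Baranyai's theorem (`exists_baranyai_partition`, proved by adding the points of the ground set
one at a time and rounding a fractional assignment with Hall's theorem), the `k`-subsets of `Fin n`
split into quadruples of pairwise disjoint sets together with at most three further pairwise
disjoint sets (`exists_partition_into_quadruples`). Since `3k < n`, some point `p` lies in none of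
the leftover sets.

Each quadruple gets a start set `B`, the one containing `p` if there is one, and a host
`S = B \ {y}` of size `k - 1` avoiding `p`, where `y = p` if `p ∈ B`. Every `(k - 1)`-set `S`
avoiding `p` is a host, namely of the quadruple containing `S ∪ {p}`. The revolving door Gray code
(`exists_cyclic_exchange_list`) lists these `(k - 1)`-sets cyclically so that neighbours differ by
one exchange, and the quadruples are listed in the order of their hosts
(`exists_list_refining`). If `B` and `T` are the start sets of consecutive quadruples, then
`|T \ B| ≤ 2`: one element comes from the exchange of hosts and one from `T` minus its host. Hence
`T` meets at most two of the three other members of the quadruple of `B`, so the quadruple can be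
traversed from `B` to a set disjoint from `T`, and the traversals concatenate to a Hamiltonian cycle.

A leftover set `v` is inserted into a quadruple whose host is `v` minus a point: `v` has at most one
element outside `B`, so it is disjoint from at least two of the other three sets, and there is
room for it between them (`exists_list_through_quadruple`). For `k ≥ 2` different leftover sets go
to different quadruples, being disjoint; for `k = 1` the graph is complete.
-/

/-! ### Baranyai's theorem -/

/-- Rounding lemma: `X` is the edge set of a bipartite multigraph between `J` and `T`. If nonnegative
weights have sum `1` at each `j` and integral sum `m t` at each `t`, then one edge of positive weight
can be chosen at each `j` so that exactly `m t` of them end at `t`. -/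
theorem exists_transversal_of_weights {X J T : Type*} [Fintype X] [Fintype J] [Fintype T]
    [DecidableEq J] [DecidableEq T] (c : X → J) (τ : X → T) (w : X → ℚ) (m : T → ℕ)
    (hw : ∀ x, 0 ≤ w x) (hc : ∀ j, ∑ x with c x = j, w x = 1)
    (hm : ∀ t, ∑ x with τ x = t, w x = m t) :
    ∃ y : J → X, (∀ j, c (y j) = j) ∧ (∀ j, 0 < w (y j)) ∧
      ∀ t, (Finset.univ.filter fun j => τ (y j) = t).card = m t := by
  classical
  have hJ : ∑ t, m t = Fintype.card J := by
    have h1 : ∑ x, w x = Fintype.card J := by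
      rw [← Finset.sum_fiberwise Finset.univ c w]
      simp [hc]
    have h2 : ∑ x, w x = ∑ t, (m t : ℚ) := by
      rw [← Finset.sum_fiberwise Finset.univ τ w]
      simp [hm]
    exact_mod_cast h2.symm.trans h1
  -- Hall's condition for matching each `j` to one of `m t` copies of a `t` reached by an edge of
  -- positive weight: the weight at `A` is at most the weight at the neighbourhood `N` of `A`.
  have hall : ∀ A : Finset J, A.card ≤ (A.biUnion fun j =>
      Finset.univ.filter fun p : (Σ t, Fin (m t)) => ∃ x, c x = j ∧ τ x = p.1 ∧ 0 < w x).card := by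
    intro A
    set N : Finset T := Finset.univ.filter fun t => ∃ x, c x ∈ A ∧ τ x = t ∧ 0 < w x with hN
    have hEq : (A.biUnion fun j => Finset.univ.filter fun p : (Σ t, Fin (m t)) =>
        ∃ x, c x = j ∧ τ x = p.1 ∧ 0 < w x) = N.sigma fun _ => Finset.univ := by
      ext ⟨t, i⟩
      simp only [Finset.mem_biUnion, Finset.mem_filter, Finset.mem_univ, true_and,
        Finset.mem_sigma, and_true, hN]
      constructor
      · rintro ⟨j, hj, x, rfl, h⟩
        exact ⟨x, hj, h⟩
      · rintro ⟨x, hx, h⟩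
        exact ⟨c x, hx, x, rfl, h⟩
    rw [hEq, Finset.card_sigma]
    simp only [Finset.card_univ, Fintype.card_fin]
    have h1 : (A.card : ℚ) = ∑ x, if c x ∈ A then w x else 0 := by
      rw [← Finset.sum_filter, ← Finset.sum_fiberwise_of_maps_to (s := Finset.univ.filter
        fun x => c x ∈ A) (t := A) (g := c) (by simp)]
      rw [Finset.card_eq_sum_ones, Nat.cast_sum]
      refine Finset.sum_congr rfl fun j hj => ?_
      rw [Nat.cast_one, ← hc j, Finset.filter_filter]
      refine Finset.sum_congr (Finset.filter_congr fun x _ => ?_) fun _ _ => rfl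
      exact ⟨fun h => ⟨h ▸ hj, h⟩, fun h => h.2⟩
    have h2 : ((∑ t ∈ N, m t : ℕ) : ℚ) = ∑ x, if τ x ∈ N then w x else 0 := by
      rw [← Finset.sum_filter, ← Finset.sum_fiberwise_of_maps_to (s := Finset.univ.filter
        fun x => τ x ∈ N) (t := N) (g := τ) (by simp)]
      rw [Nat.cast_sum]
      refine Finset.sum_congr rfl fun j hj => ?_
      rw [← hm j, Finset.filter_filter]
      refine Finset.sum_congr (Finset.filter_congr fun x _ => ?_) fun _ _ => rfl
      exact ⟨fun h => ⟨h ▸ hj, h⟩, fun h => h.2⟩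
    have h3 : (A.card : ℚ) ≤ ((∑ t ∈ N, m t : ℕ) : ℚ) := by
      rw [h1, h2]
      refine Finset.sum_le_sum fun x _ => ?_
      by_cases hx : c x ∈ A
      · rcases (hw x).eq_or_lt with h0 | h0
        · rw [← h0]; simp
        · have : τ x ∈ N := by
            rw [hN, Finset.mem_filter]
            exact ⟨Finset.mem_univ _, x, hx, rfl, h0⟩
          simp [hx, this]
      · rw [if_neg hx]
        split_ifs
        exacts [hw x, le_rfl]
    exact_mod_cast h3
  obtain ⟨f, hf, hfm⟩ := (Finset.all_card_le_biUnion_card_iff_exists_injective _).1 hall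
  have hfm' : ∀ j, ∃ x, c x = j ∧ τ x = (f j).1 ∧ 0 < w x := fun j => by
    simpa using hfm j
  choose y hy1 hy2 hy3 using hfm'
  refine ⟨y, hy1, hy3, fun t => ?_⟩
  -- The two sides have equal size, so every copy of `t` is used.
  have hbij : Function.Bijective f := by
    rw [Fintype.bijective_iff_injective_and_card]
    exact ⟨hf, by simp [hJ]⟩
  have : (Finset.univ.filter fun j => τ (y j) = t).map ⟨f, hf⟩
      = (Finset.univ : Finset (Fin (m t))).map ⟨Sigma.mk t, sigma_mk_injective⟩ := by
    ext ⟨t', i⟩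
    simp only [hy2, Finset.mem_map, Finset.mem_filter, Finset.mem_univ, true_and,
      Function.Embedding.coeFn_mk]
    constructor
    · rintro ⟨j, hj, hj'⟩
      rw [hj'] at hj
      obtain rfl : t' = t := hj
      exact ⟨i, rfl⟩
    · rintro ⟨i', h⟩
      obtain ⟨j, hj⟩ := hbij.2 ⟨t', i⟩
      refine ⟨j, ?_, hj⟩
      rw [hj, ← h]
  have hcard := congrArg Finset.card this
  simpa using hcard

/-- The induction behind Baranyai's theorem. The elements of `X` are slots, grouped into cells by
`c`; the `real` slots are to become the `k`-sets and the others take up the points of a cell that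
its `k`-sets do not cover. After the points of `U` have been distributed, `f x` is the part of slot
`x` inside `U`: each cell is partitioned, no slot exceeds its capacity, and the number of real slots
with trace `S` on `U` is the number of `k`-sets with that trace. -/
theorem exists_partial_baranyai {α X J : Type*} [Fintype α] [DecidableEq α] [Fintype X]
    [DecidableEq X] [Fintype J] [DecidableEq J] (c : X → J) (real : X → Prop) [DecidablePred real]
    (cap : X → ℕ) (k : ℕ) (hreal : ∀ x, real x → cap x = k)
    (hcap : ∀ j, ∑ x with c x = j, cap x = Fintype.card α)
    (hcard : (Finset.univ.filter real).card = (Fintype.card α).choose k) (U : Finset α) :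
    ∃ f : X → Finset α, (∀ x, f x ⊆ U) ∧ (∀ x, (f x).card ≤ cap x) ∧
      (∀ j, ∑ x with c x = j, (f x).card = U.card) ∧
      (∀ x x', c x = c x' → x ≠ x' → Disjoint (f x) (f x')) ∧
      ∀ S ⊆ U, S.card ≤ k → (Finset.univ.filter fun x => real x ∧ f x = S).card =
        (Fintype.card α - U.card).choose (k - S.card) := by
  induction U using Finset.induction_on with
  | empty =>
    refine ⟨fun _ => ∅, by simp, by simp, by simp, by simp, ?_⟩
    intro S hS _
    obtain rfl := Finset.subset_empty.1 hS
    simpa using hcard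
  | insert a U ha ih =>
    obtain ⟨f, hfU, hfc, hfs, hfd, hfn⟩ := ih
    have hlt : U.card < Fintype.card α := by
      have := Finset.card_le_univ (insert a U)
      rw [Finset.card_insert_of_notMem ha] at this
      omega
    obtain ⟨r, hr⟩ : ∃ r, Fintype.card α = U.card + (r + 1) :=
      ⟨Fintype.card α - U.card - 1, by omega⟩
    have hr1 : Fintype.card α - U.card = r + 1 := by omega
    have hr2 : Fintype.card α - (insert a U).card = r := by
      rw [Finset.card_insert_of_notMem ha]; omega
    -- Fractionally, the new point `a` goes to each slot in proportion to the room left there. The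
    -- weights sum to `1` on each cell, and to the binomial number `m₀ S` on the real slots with
    -- trace `S`, so rounding gives a slot in each cell that can receive `a`.
    set w : X → ℚ := fun x => ((cap x : ℚ) - (f x).card) / (r + 1) with hwdef
    have hrpos : (0 : ℚ) < r + 1 := by positivity
    have hw : ∀ x, 0 ≤ w x := fun x => by
      have : ((f x).card : ℚ) ≤ cap x := by exact_mod_cast hfc x
      exact div_nonneg (by linarith) hrpos.le
    have hc : ∀ j, ∑ x with c x = j, w x = 1 := fun j => by
      rw [hwdef, ← Finset.sum_div, Finset.sum_sub_distrib, ← Nat.cast_sum, ← Nat.cast_sum,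
        hcap j, hfs j, hr]
      push_cast
      rw [add_sub_cancel_left, div_self hrpos.ne']
    set τ : X → Option (Finset α) := fun x => if real x then some (f x) else none with hτ
    have hτs : ∀ x S, τ x = some S ↔ real x ∧ f x = S := fun x S => by
      simp only [hτ]; split_ifs with h <;> simp [h]
    set m₀ : Finset α → ℕ := fun S =>
      if S ⊆ U ∧ S.card < k then r.choose (k - S.card - 1) else 0 with hm₀
    have hm₀' : ∀ S, ∑ x with τ x = some S, w x = m₀ S := fun S => by
      simp only [hτs]
      have h1 : ∑ x with real x ∧ f x = S, w x =
          ∑ x with real x ∧ f x = S, ((k : ℚ) - S.card) / (r + 1) := by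
        refine Finset.sum_congr rfl fun x hx => ?_
        obtain ⟨hx1, hx2⟩ := (Finset.mem_filter.1 hx).2
        simp only [hwdef, hreal x hx1, hx2]
      rw [h1, Finset.sum_const, nsmul_eq_mul]
      by_cases hS : S ⊆ U
      · rcases lt_trichotomy S.card k with h | h | h
        · rw [hfn S hS h.le, hr1, hm₀]
          simp only [hS, h, and_self, if_true]
          obtain ⟨d, hd⟩ : ∃ d, k = S.card + (d + 1) := ⟨k - S.card - 1, by omega⟩
          have e1 : k - S.card = d + 1 := by omega
          have e2 : (k : ℚ) - S.card = d + 1 := by rw [hd]; push_cast; ring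
          rw [e1, e2, Nat.add_sub_cancel]
          have := Nat.add_one_mul_choose_eq r d
          have h' : ((r : ℚ) + 1) * r.choose d = (r + 1).choose (d + 1) * (d + 1) := by
            exact_mod_cast this
          field_simp
          linarith
        · have : ((S.card : ℕ) : ℚ) = k := by exact_mod_cast h
          rw [this, hm₀]; simp [h]
        · have : (Finset.univ.filter fun x => real x ∧ f x = S) = ∅ := by
            refine Finset.filter_eq_empty_iff.2 ?_
            rintro x - ⟨hx1, hx2⟩
            have := hfc x
            rw [hreal x hx1, hx2] at this
            omega
          rw [this, hm₀]; simp [h.not_gt]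
      · have : (Finset.univ.filter fun x => real x ∧ f x = S) = ∅ := by
          refine Finset.filter_eq_empty_iff.2 ?_
          rintro x - ⟨hx1, hx2⟩
          exact hS (hx2 ▸ hfU x)
        rw [this, hm₀]; simp [hS]
    have htot : ∑ x, w x = Fintype.card J := by
      rw [← Finset.sum_fiberwise Finset.univ c w]
      simp [hc]
    have htot' : ∑ x, w x = ∑ x with τ x = none, w x + ((∑ S, m₀ S : ℕ) : ℚ) := by
      rw [← Finset.sum_fiberwise Finset.univ τ w, Fintype.sum_option]
      simp [hm₀']
    have hle : ∑ S, m₀ S ≤ Fintype.card J := by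
      have : 0 ≤ ∑ x with τ x = none, w x := Finset.sum_nonneg fun x _ => hw x
      have : ((∑ S, m₀ S : ℕ) : ℚ) ≤ Fintype.card J := by linarith
      exact_mod_cast this
    -- The slots that are not real form a single class, whose weight is an integer by difference.
    obtain ⟨y, hyc, hyw, hyt⟩ := exists_transversal_of_weights c τ w
      (fun t => t.elim (Fintype.card J - ∑ S, m₀ S) m₀) hw hc (by
        rintro (_ | S)
        · simp only [Option.elim]
          rw [Nat.cast_sub hle]
          linarith
        · exact hm₀' S)
    have hfa : ∀ x, a ∉ f x := fun x h => ha (hfU x h)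
    set g : X → Finset α := fun x => if y (c x) = x then insert a (f x) else f x with hg
    have hgc : ∀ x, (g x).card = (f x).card + if y (c x) = x then 1 else 0 := fun x => by
      simp only [hg]; split_ifs
      · rw [Finset.card_insert_of_notMem (hfa x)]
      · rfl
    have hsel : ∀ S, (Finset.univ.filter fun x =>
        (real x ∧ f x = S) ∧ y (c x) = x).card = m₀ S := fun S => by
      have := hyt (some S)
      simp only [Option.elim] at this
      rw [← this, ← Finset.card_map ⟨y, fun j j' h => by rw [← hyc j, h, hyc]⟩]
      congr 1
      ext x
      simp only [Finset.mem_filter, Finset.mem_univ, true_and, Finset.mem_map, hτs]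
      constructor
      · rintro ⟨h, h'⟩
        exact ⟨c x, by rw [h']; exact h, h'⟩
      · rintro ⟨j, h, rfl⟩
        exact ⟨h, congrArg y (hyc j)⟩
    refine ⟨g, fun x => ?_, fun x => ?_, fun j => ?_, fun x x' hx hne => ?_, fun S hS hSk => ?_⟩
    · simp only [hg]; split_ifs
      · exact Finset.insert_subset_insert _ (hfU x)
      · exact (hfU x).trans (Finset.subset_insert _ _)
    · rw [hgc]; split_ifs with h
      · have := hyw (c x)
        rw [h] at this
        have h2 := (div_pos_iff_of_pos_right hrpos).1 this
        have h3 : ((f x).card : ℚ) < cap x := by linarith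
        exact_mod_cast h3
      · exact hfc x
    · simp only [hgc, Finset.sum_add_distrib, hfs j]
      rw [Finset.card_insert_of_notMem ha, Finset.sum_eq_single (y j)]
      · simp [hyc]
      · intro x hx hxy
        rw [(Finset.mem_filter.1 hx).2, if_neg (Ne.symm hxy)]
      · simp [hyc]
    · have hd := hfd x x' hx hne
      simp only [hg]; split_ifs with h1 h2 h2
      · exact absurd (h1.symm.trans ((congrArg y hx).trans h2)) hne
      · exact Finset.disjoint_insert_left.2 ⟨hfa _, hd⟩
      · exact Finset.disjoint_insert_right.2 ⟨hfa _, hd⟩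
      · exact hd
    · rw [hr2]
      by_cases haS : a ∈ S
      · obtain ⟨S', haS', rfl⟩ : ∃ S', a ∉ S' ∧ insert a S' = S :=
          ⟨S.erase a, Finset.notMem_erase _ _, Finset.insert_erase haS⟩
        have hS' : S' ⊆ U := (Finset.insert_subset_insert_iff haS').1 hS
        rw [Finset.card_insert_of_notMem haS'] at hSk ⊢
        have := hsel S'
        rw [hm₀] at this
        simp only [hS', true_and] at this
        rw [if_pos (by omega)] at this
        rw [← Nat.sub_sub, ← this]
        congr 1
        ext x
        simp only [Finset.mem_filter, Finset.mem_univ, true_and, hg]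
        split_ifs with h
        · simp only [h, and_true]
          refine and_congr_right fun _ => ⟨fun h' => ?_, fun h' => by rw [h']⟩
          rw [← Finset.erase_insert (hfa x), h', Finset.erase_insert haS']
        · simp only [h, and_false, iff_false, not_and]
          intro _ h'
          exact hfa x (h' ▸ Finset.mem_insert_self _ _)
      · have hSU : S ⊆ U := (Finset.subset_insert_iff_of_notMem haS).1 hS
        have h1 := hsel S
        have h2 := hfn S hSU hSk
        -- Slots of trace `S` that do not receive `a` keep that trace; the count is Pascal's rule.
        have h3 : (Finset.univ.filter fun x => real x ∧ g x = S) =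
            Finset.univ.filter fun x => (real x ∧ f x = S) ∧ ¬ y (c x) = x := by
          ext x
          simp only [Finset.mem_filter, Finset.mem_univ, true_and, hg]
          split_ifs with h
          · simp only [h, not_true_eq_false, and_false, iff_false, not_and]
            intro _ h'
            exact haS (h' ▸ Finset.mem_insert_self _ _)
          · simp [h]
        rw [h3]
        have h4 := Finset.card_filter_add_card_filter_not
          (s := Finset.univ.filter fun x => real x ∧ f x = S) (fun x => y (c x) = x)
        rw [Finset.filter_filter, Finset.filter_filter, h1, h2, hr1] at h4
        rw [hm₀] at h4
        simp only [hSU, true_and] at h4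
        rcases hSk.lt_or_eq with h | h
        · rw [if_pos h] at h4
          obtain ⟨d, hd⟩ : ∃ d, k - S.card = d + 1 := ⟨k - S.card - 1, by omega⟩
          rw [hd, Nat.choose_succ_succ', Nat.add_sub_cancel] at h4
          rw [hd]
          omega
        · simp [h] at h4 ⊢
          omega

/-- Baranyai's theorem: for any sizes with `size j * k ≤ |α|` that add up to the number of `k`-subsets
of `α`, the `k`-subsets split into families of these sizes, each of pairwise disjoint sets. -/
theorem exists_baranyai_partition {α J : Type*} [Fintype α] [DecidableEq α] [Fintype J]
    [DecidableEq J] (k : ℕ) (size : J → ℕ) (hsize : ∀ j, size j * k ≤ Fintype.card α)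
    (hsum : ∑ j, size j = (Fintype.card α).choose k) :
    ∃ g : (Σ j, Fin (size j)) → Finset α, (∀ x, (g x).card = k) ∧ Function.Injective g ∧
      (∀ s : Finset α, s.card = k → ∃ x, g x = s) ∧
      ∀ j i i', i ≠ i' → Disjoint (g ⟨j, i⟩) (g ⟨j, i'⟩) := by
  classical
  -- Slot `none` of a cell collects the points not covered by its `k`-sets.
  obtain ⟨f, -, hfc, -, hfd, hfn⟩ := exists_partial_baranyai
    (X := Σ j, Option (Fin (size j))) (J := J) (α := α) (fun x => x.1)
    (fun x => x.2.isSome) (fun x => x.2.elim (Fintype.card α - size x.1 * k) fun _ => k) k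
    (by rintro ⟨j, _ | i⟩ <;> simp)
    (by
      intro j
      rw [Finset.sum_filter, Fintype.sum_sigma, Finset.sum_eq_single j]
      · simp [hsize j]
      · intro j' _ hj'
        simp [hj']
      · simp)
    (by
      rw [← hsum, Finset.card_filter, Fintype.sum_sigma]
      refine Finset.sum_congr rfl fun j _ => ?_
      rw [Fintype.sum_option]
      simp)
    Finset.univ
  have key : ∀ S : Finset α, S.card ≤ k →
      (Finset.univ.filter fun x : (Σ j, Option (Fin (size j))) => x.2.isSome ∧ f x = S).card =
        Nat.choose 0 (k - S.card) := by
    intro S hS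
    have := hfn S (Finset.subset_univ _) hS
    simpa using this
  have hcard : ∀ j (i : Fin (size j)), (f ⟨j, some i⟩).card = k := by
    intro j i
    have h1 : (f ⟨j, some i⟩).card ≤ k := hfc ⟨j, some i⟩
    by_contra hne
    have h2 := key _ h1
    rw [Nat.choose_eq_zero_of_lt (by omega), Finset.card_eq_zero] at h2
    have : (⟨j, some i⟩ : Σ j, Option (Fin (size j))) ∈ (∅ : Finset _) := by
      rw [← h2]; simp
    simp at this
  refine ⟨fun x => f ⟨x.1, some x.2⟩, fun x => hcard _ _, ?_, ?_, ?_⟩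
  · rintro ⟨j, i⟩ ⟨j', i'⟩ h
    simp only at h
    have h2 := key (f ⟨j, some i⟩) (hcard _ _).le
    rw [hcard, Nat.sub_self, Nat.choose_zero_right, Finset.card_eq_one] at h2
    obtain ⟨x, hx⟩ := h2
    have e1 : (⟨j, some i⟩ : Σ j, Option (Fin (size j))) = x := by
      rw [← Finset.mem_singleton, ← hx]; simp
    have e2 : (⟨j', some i'⟩ : Σ j, Option (Fin (size j))) = x := by
      rw [← Finset.mem_singleton, ← hx]; simp [h]
    have e3 := e1.trans e2.symm
    rw [Sigma.mk.injEq] at e3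
    obtain ⟨rfl, e4⟩ := e3
    simpa using e4
  · intro s hs
    have h2 := key s hs.le
    rw [hs, Nat.sub_self, Nat.choose_zero_right, Finset.card_eq_one] at h2
    obtain ⟨⟨j, o⟩, hx⟩ := h2
    have h3 : (⟨j, o⟩ : Σ j, Option (Fin (size j))) ∈ Finset.univ.filter
        fun x : (Σ j, Option (Fin (size j))) => x.2.isSome ∧ f x = s := by rw [hx]; simp
    obtain ⟨h4, h5⟩ := (Finset.mem_filter.1 h3).2
    rcases o with _ | i
    · simp at h4
    · exact ⟨⟨j, i⟩, h5⟩
  · intro j i i' hii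
    exact hfd _ _ rfl (by simpa using hii)

/-! ### The revolving door Gray code -/

/-- Finite sets `S` and `T` are exchange-close if each has at most one element outside the other. -/
def ExchangeClose {α : Type*} [DecidableEq α] (S T : Finset α) : Prop :=
  (S \ T).card ≤ 1 ∧ (T \ S).card ≤ 1

theorem ExchangeClose.symm {α : Type*} [DecidableEq α] {S T : Finset α}
    (h : ExchangeClose S T) : ExchangeClose T S :=
  ⟨h.2, h.1⟩

theorem ExchangeClose.insert {α : Type*} [DecidableEq α] {S T : Finset α}
    (h : ExchangeClose S T) (a : α) : ExchangeClose (insert a S) (insert a T) := by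
  constructor
  · refine (Finset.card_le_card fun x hx => ?_).trans h.1
    simp only [Finset.mem_sdiff, Finset.mem_insert] at hx ⊢
    tauto
  · refine (Finset.card_le_card fun x hx => ?_).trans h.2
    simp only [Finset.mem_sdiff, Finset.mem_insert] at hx ⊢
    tauto

theorem exchangeClose_insert_insert {α : Type*} [DecidableEq α] (a b : α) (S : Finset α) :
    ExchangeClose (insert a S) (insert b S) := by
  constructor
  · refine (Finset.card_le_card (t := {a}) fun x hx => ?_).trans (Finset.card_singleton a).le
    simp only [Finset.mem_sdiff, Finset.mem_insert, Finset.mem_singleton] at hx ⊢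
    tauto
  · refine (Finset.card_le_card (t := {b}) fun x hx => ?_).trans (Finset.card_singleton b).le
    simp only [Finset.mem_sdiff, Finset.mem_insert, Finset.mem_singleton] at hx ⊢
    tauto

/-- The revolving door list of the `k`-subsets of `{e 0, …, e (n - 1)}`, from `{e 0, …, e (k - 1)}` to
`{e 0, …, e (k - 2), e (n - 1)}`: the list for `n + 1` is the list for `n`, followed by the reversed
list of the `(k - 1)`-subsets with `e n` added to each. The ends are specified because both the
induction and the closing of the cycle need them. -/
theorem exists_revolving_door_list {α : Type*} [DecidableEq α] (e : ℕ → α) (n : ℕ)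
    (he : Set.InjOn e (Finset.range n)) (k : ℕ) (hk : k ≤ n) :
    ∃ L : List (Finset α), L.Nodup ∧
      (∀ S, S ∈ L ↔ S ∈ Finset.powersetCard k ((Finset.range n).image e)) ∧
      L.IsChain ExchangeClose ∧ L.head? = some ((Finset.range k).image e) ∧
      L.getLast? = some (if k = 0 then ∅ else insert (e (n - 1)) ((Finset.range (k - 1)).image e)) := by
  induction n generalizing k with
  | zero =>
    obtain rfl : k = 0 := by omega
    exact ⟨[∅], by simp⟩
  | succ n ih =>
    rcases k with _ | k
    · exact ⟨[∅], by simp⟩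
    have he' : Set.InjOn e (Finset.range n) := he.mono (by
      intro x; simp only [Finset.coe_range, Set.mem_Iio]; omega)
    have hen : e n ∉ (Finset.range n).image e := by
      intro h
      obtain ⟨i, hi, hin⟩ := Finset.mem_image.1 h
      rw [Finset.mem_range] at hi
      have := he (by simp; omega) (by simp) hin
      omega
    rcases Nat.lt_or_ge n (k + 1) with hnk | hnk
    · obtain rfl : k = n := by omega
      refine ⟨[(Finset.range (k + 1)).image e], by simp, fun S => ?_, by simp, by simp, ?_⟩
      · have : ((Finset.range (k + 1)).image e).card = k + 1 := by
          rw [Finset.card_image_of_injOn he, Finset.card_range]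
        have h2 := Finset.powersetCard_self ((Finset.range (k + 1)).image e)
        rw [this] at h2
        rw [h2]; simp
      · simp [Finset.range_add_one]
    · obtain ⟨L, hLn, hLm, hLc, hLh, hLl⟩ := ih he' (k + 1) hnk
      obtain ⟨M, hMn, hMm, hMc, hMh, hMl⟩ := ih he' k (by omega)
      have hMa : ∀ S ∈ M, e n ∉ S := fun S hS h =>
        hen ((Finset.mem_powersetCard.1 ((hMm S).1 hS)).1 h)
      refine ⟨L ++ (M.reverse.map (insert (e n))), ?_, fun S => ?_, ?_, ?_, ?_⟩
      · rw [List.nodup_append]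
        refine ⟨hLn, ?_, ?_⟩
        · refine List.Nodup.map_on ?_ (List.nodup_reverse.2 hMn)
          intro S hS T hT hST
          rw [List.mem_reverse] at hS hT
          rw [← Finset.erase_insert (hMa S hS), hST, Finset.erase_insert (hMa T hT)]
        · rintro S hS T hT rfl
          obtain ⟨T, -, rfl⟩ := List.mem_map.1 hT
          exact hen ((Finset.mem_powersetCard.1 ((hLm _).1 hS)).1 (Finset.mem_insert_self _ _))
      · rw [List.mem_append, hLm, Finset.range_add_one, Finset.image_insert,
          Finset.powersetCard_succ_insert hen, Finset.mem_union, Finset.mem_image]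
        simp [hMm]
      · rw [List.isChain_append]
        refine ⟨hLc, ?_, ?_⟩
        · refine List.isChain_map_of_isChain (R := ExchangeClose) _ (fun _ _ h => h.insert _) ?_
          rw [List.isChain_reverse]
          exact hMc.imp fun _ _ h => h.symm
        · rw [hLl, List.head?_map, List.head?_reverse, hMl]
          intro x hx y hy
          obtain rfl : _ = x := by simpa using hx
          obtain rfl : _ = y := by simpa using hy
          rcases k with _ | k
          · simpa using exchangeClose_insert_insert (e (n - 1)) (e n) (∅ : Finset α)
          · simp only [Nat.add_sub_cancel, Nat.add_eq_zero_iff, one_ne_zero, and_false, if_false]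
            have := exchangeClose_insert_insert (e k) (e n)
              (insert (e (n - 1)) ((Finset.range k).image e))
            rwa [Finset.insert_comm, ← Finset.image_insert, ← Finset.range_add_one] at this
      · rw [List.head?_append, hLh]; rfl
      · rw [List.getLast?_append, List.getLast?_map, List.getLast?_reverse, hMh]
        simp

/-- The `k`-subsets of a finite set can be arranged in a cycle in which neighbours differ by at most
one exchange of elements. -/
theorem exists_cyclic_exchange_list {α : Type*} [DecidableEq α] [Nonempty α] (U : Finset α) (k : ℕ)
    (hk : k ≤ U.card) :
    ∃ L : List (Finset α), L.Nodup ∧ (∀ S, S ∈ L ↔ S ∈ Finset.powersetCard k U) ∧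
      L.IsChain ExchangeClose ∧ ∀ S ∈ L.getLast?, ∀ T ∈ L.head?, ExchangeClose S T := by
  obtain ⟨e, he, heU⟩ : ∃ e : ℕ → α, Set.InjOn e (Finset.range U.card) ∧
      (Finset.range U.card).image e = U := by
    refine ⟨fun i => if h : i < U.card then U.equivFin.symm ⟨i, h⟩ else Classical.arbitrary α,
      fun i hi j hj hij => ?_, ?_⟩
    · simp only [Finset.coe_range, Set.mem_Iio] at hi hj
      simpa [hi, hj] using hij
    · ext a
      simp only [Finset.mem_image, Finset.mem_range]
      constructor
      · rintro ⟨i, hi, rfl⟩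
        simp [hi]
      · intro ha
        exact ⟨U.equivFin ⟨a, ha⟩, (U.equivFin ⟨a, ha⟩).2, by simp⟩
  obtain ⟨L, h1, h2, h3, h4, h5⟩ := exists_revolving_door_list e U.card he k hk
  rw [heU] at h2
  refine ⟨L, h1, h2, h3, ?_⟩
  rw [h4, h5]
  intro S hS T hT
  obtain rfl : _ = S := by simpa using hS
  obtain rfl : _ = T := by simpa using hT
  rcases k with _ | k
  · simp [ExchangeClose]
  · simpa [Finset.range_add_one] using exchangeClose_insert_insert _ _ _

/-! ### Lists and Hamiltonian cycles -/

theorem SimpleGraph.isHamiltonian_of_list {V : Type*} [Fintype V] [DecidableEq V]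
    (G : SimpleGraph V) (l : List V) (hnd : l.Nodup) (hmem : ∀ v, v ∈ l) (hcard : 3 ≤ Fintype.card V)
    (hch : l.IsChain G.Adj) (hclose : ∀ x ∈ l.getLast?, ∀ y ∈ l.head?, G.Adj x y) :
    G.IsHamiltonian := by
  intro _
  have hlen : 3 ≤ l.length := by
    rwa [← List.toFinset_card_of_nodup hnd, Finset.eq_univ_iff_forall.2 fun v =>
      List.mem_toFinset.2 (hmem v)]
  have hne : l ≠ [] := by rintro rfl; simp at hlen
  have hadj : G.Adj (l.getLast hne) (l.head hne) :=
    hclose _ (by simp [List.getLast?_eq_getLast_of_ne_nil hne]) _ (by simp [List.head?_eq_some_head hne])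
  refine ⟨_, .cons hadj (.ofSupport l hne hch), ?_⟩
  have hp : (SimpleGraph.Walk.ofSupport l hne hch).IsPath :=
    SimpleGraph.Walk.IsPath.mk' (by rwa [SimpleGraph.Walk.support_ofSupport])
  rw [SimpleGraph.Walk.isHamiltonianCycle_iff_isCycle_and_support_count_tail_eq_one]
  constructor
  · rw [SimpleGraph.Walk.cons_isCycle_iff]
    refine ⟨hp, fun h => ?_⟩
    have := hp.length_eq_one_of_mem_edges (Sym2.eq_swap ▸ h)
    rw [SimpleGraph.Walk.length_ofSupport] at this
    omega
  · intro a
    simpa using List.count_eq_one_of_mem hnd (hmem a)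

/-- Replacing each `b` in the list `L` by its fibre under `f` gives a list of the `j` with `f j ∈ L`
that is a chain for the pulled-back relation. Empty fibres would break the chain, hence `hsurj`. -/
theorem exists_list_refining {J β : Type*} [Fintype J] [DecidableEq β] (f : J → β)
    (R : β → β → Prop) (hR : ∀ b, R b b) (L : List β) (hnd : L.Nodup) (hch : L.IsChain R)
    (hsurj : ∀ b ∈ L, ∃ j, f j = b) :
    ∃ js : List J, js.Nodup ∧ (∀ j, j ∈ js ↔ f j ∈ L) ∧ js.IsChain (fun i j => R (f i) (f j)) ∧
      js.head?.map f = L.head? ∧ js.getLast?.map f = L.getLast? := by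
  induction L with
  | nil => exact ⟨[], by simp⟩
  | cons b L ih =>
    obtain ⟨hb, hnd'⟩ := List.nodup_cons.1 hnd
    obtain ⟨js, h1, h2, h3, h4, h5⟩ := ih hnd' hch.of_cons fun c hc => hsurj c (by simp [hc])
    obtain ⟨A, hA, hAm⟩ : ∃ A : List J, A.Nodup ∧ ∀ j, j ∈ A ↔ f j = b :=
      ⟨(Finset.univ.filter fun j => f j = b).toList, Finset.nodup_toList _, by simp⟩
    have hAne : A ≠ [] := by
      obtain ⟨j, hj⟩ := hsurj b (by simp)
      exact List.ne_nil_of_mem ((hAm j).2 hj)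
    refine ⟨A ++ js, ?_, fun j => ?_, ?_, ?_, ?_⟩
    · rw [List.nodup_append]
      refine ⟨hA, h1, ?_⟩
      rintro x hx y hy rfl
      exact hb ((hAm x).1 hx ▸ (h2 x).1 hy)
    · rw [List.mem_append, hAm, h2, List.mem_cons]
    · rw [List.isChain_append]
      refine ⟨?_, h3, fun x hx y hy => ?_⟩
      · refine List.Pairwise.isChain (List.pairwise_of_forall_mem_list fun x hx y hy => ?_)
        rw [(hAm x).1 hx, (hAm y).1 hy]
        exact hR b
      · rw [(hAm x).1 (List.mem_of_mem_getLast? hx)]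
        rw [List.isChain_cons] at hch
        refine hch.1 _ ?_
        rw [← h4, Option.mem_def.1 hy]
        rfl
    · rw [List.head?_append_of_ne_nil _ hAne, List.head?_eq_some_head hAne]
      simp [(hAm _).1 (List.head_mem hAne)]
    · rcases L with _ | ⟨c, L⟩
      · have : js = [] := by simpa using h4
        rw [this, List.append_nil, List.getLast?_eq_getLast_of_ne_nil hAne]
        simp [(hAm _).1 (List.getLast_mem hAne)]
      · have : js ≠ [] := by rintro rfl; simp at h4
        rw [List.getLast?_append_of_ne_nil _ this, h5, List.getLast?_cons_cons]

/-- Concatenation of paths: the fibres of `own` are blocks with a start vertex, and whenever `R j j'`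
holds, block `j` can be traversed from its start to a neighbour of the start of block `j'`. Then the
blocks in an `R`-chain can be traversed in order, ending at a neighbour of the start of block `t`. -/
theorem exists_list_through_blocks {V J : Type*} (G : SimpleGraph V) (own : V → J)
    (start : J → V) (R : J → J → Prop)
    (hpath : ∀ j j', R j j' → ∃ l : List V, l.Nodup ∧ (∀ x, x ∈ l ↔ own x = j) ∧
      l.IsChain G.Adj ∧ l.head? = some (start j) ∧ ∀ x ∈ l.getLast?, G.Adj x (start j'))
    (js : List J) (j t : J) (hnd : (j :: js).Nodup) (hch : (j :: js).IsChain R)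
    (hlast : ∀ i ∈ (j :: js).getLast?, R i t) :
    ∃ l : List V, l.Nodup ∧ (∀ x, x ∈ l ↔ own x ∈ j :: js) ∧ l.IsChain G.Adj ∧
      l.head? = some (start j) ∧ ∀ x ∈ l.getLast?, G.Adj x (start t) := by
  induction js generalizing j with
  | nil =>
    obtain ⟨l, h1, h2, h3, h4, h5⟩ := hpath j t (hlast j rfl)
    exact ⟨l, h1, by simpa using h2, h3, h4, h5⟩
  | cons i js ih =>
    obtain ⟨hji, hch'⟩ := List.isChain_cons_cons.1 hch
    obtain ⟨hj, hnd'⟩ := List.nodup_cons.1 hnd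
    obtain ⟨m, m1, m2, m3, m4, m5⟩ := ih i hnd' hch' (by simpa using hlast)
    obtain ⟨l, h1, h2, h3, h4, h5⟩ := hpath j i hji
    refine ⟨l ++ m, ?_, fun x => ?_, ?_, ?_, ?_⟩
    · rw [List.nodup_append]
      refine ⟨h1, m1, ?_⟩
      rintro x hx y hy rfl
      exact hj ((h2 x).1 hx ▸ (m2 x).1 hy)
    · rw [List.mem_append, h2, m2, List.mem_cons (a := own x) (b := j)]
    · rw [List.isChain_append]
      refine ⟨h3, m3, fun x hx y hy => ?_⟩
      obtain rfl : start i = y := by simpa [m4] using hy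
      exact h5 x hx
    · rw [List.head?_append, h4]; rfl
    · intro x hx
      refine m5 x ?_
      have hm : m ≠ [] := by rintro rfl; simp at m4
      rwa [List.getLast?_append_of_ne_nil _ hm] at hx

/-! ### Traversing a quadruple of disjoint sets -/

theorem disjoint_or_disjoint_of_card_sdiff_le_one {α : Type*} [DecidableEq α]
    {v B C D : Finset α} (hv : (v \ B).card ≤ 1) (hBC : Disjoint B C) (hBD : Disjoint B D)
    (hCD : Disjoint C D) : Disjoint v C ∨ Disjoint v D := by
  by_contra! h
  obtain ⟨x, hxv, hxC⟩ := Finset.not_disjoint_iff.1 h.1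
  obtain ⟨y, hyv, hyD⟩ := Finset.not_disjoint_iff.1 h.2
  have hx : x ∈ v \ B := Finset.mem_sdiff.2 ⟨hxv, Finset.disjoint_right.1 hBC hxC⟩
  have hy : y ∈ v \ B := Finset.mem_sdiff.2 ⟨hyv, Finset.disjoint_right.1 hBD hyD⟩
  have := Finset.card_le_one.1 hv x hx y hy
  exact Finset.disjoint_left.1 hCD hxC (this ▸ hyD)

theorem exists_disjoint_of_card_sdiff_le_two {α : Type*} [DecidableEq α]
    {T B C D E : Finset α} (hT : (T \ B).card ≤ 2) (hBC : Disjoint B C) (hBD : Disjoint B D)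
    (hBE : Disjoint B E) (hCD : Disjoint C D) (hCE : Disjoint C E) (hDE : Disjoint D E) :
    Disjoint C T ∨ Disjoint D T ∨ Disjoint E T := by
  by_contra! h
  obtain ⟨x, hxC, hxT⟩ := Finset.not_disjoint_iff.1 h.1
  obtain ⟨y, hyD, hyT⟩ := Finset.not_disjoint_iff.1 h.2.1
  obtain ⟨z, hzE, hzT⟩ := Finset.not_disjoint_iff.1 h.2.2
  have hx : x ∈ T \ B := Finset.mem_sdiff.2 ⟨hxT, Finset.disjoint_right.1 hBC hxC⟩
  have hy : y ∈ T \ B := Finset.mem_sdiff.2 ⟨hyT, Finset.disjoint_right.1 hBD hyD⟩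
  have hz : z ∈ T \ B := Finset.mem_sdiff.2 ⟨hzT, Finset.disjoint_right.1 hBE hzE⟩
  refine absurd (Finset.two_lt_card.2 ⟨x, hx, y, hy, z, hz, ?_, ?_, ?_⟩) hT.not_gt
  · rintro rfl; exact Finset.disjoint_left.1 hCD hxC hyD
  · rintro rfl; exact Finset.disjoint_left.1 hCE hxC hzE
  · rintro rfl; exact Finset.disjoint_left.1 hDE hyD hzE

theorem kneserGraph_adj_iff {n k : ℕ} (hk : 1 ≤ k) {x y : {s : Finset (Fin n) // s.card = k}} :
    (kneserGraph n k).Adj x y ↔ Disjoint x.1 y.1 := by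
  refine ⟨fun h => h.2, fun h => ⟨?_, h⟩⟩
  rintro rfl
  have := x.2
  rw [disjoint_self.1 h] at this
  simp at this
  omega

/-- A quadruple of disjoint sets can be traversed from `B` to `E`, visiting on the way one extra set
that has at most one element outside `B`. -/
theorem exists_list_through_quadruple_ending_at {n k : ℕ} (hk : 1 ≤ k)
    (B C D E : {s : Finset (Fin n) // s.card = k}) (hBC : Disjoint B.1 C.1)
    (hBD : Disjoint B.1 D.1) (hBE : Disjoint B.1 E.1) (hCD : Disjoint C.1 D.1)
    (hCE : Disjoint C.1 E.1) (hDE : Disjoint D.1 E.1)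
    (extra : Option {s : Finset (Fin n) // s.card = k})
    (hextra : ∀ v ∈ extra, (v.1 \ B.1).card ≤ 1 ∧ v ≠ B ∧ v ≠ C ∧ v ≠ D ∧ v ≠ E) :
    ∃ l : List {s : Finset (Fin n) // s.card = k}, l.Nodup ∧
      (∀ x, x ∈ l ↔ (x = B ∨ x = C ∨ x = D ∨ x = E) ∨ x ∈ extra) ∧
      l.IsChain (kneserGraph n k).Adj ∧ l.head? = some B ∧ l.getLast? = some E := by
  have nBC := ((kneserGraph_adj_iff hk).2 hBC).ne
  have nBD := ((kneserGraph_adj_iff hk).2 hBD).ne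
  have nBE := ((kneserGraph_adj_iff hk).2 hBE).ne
  have nCD := ((kneserGraph_adj_iff hk).2 hCD).ne
  have nCE := ((kneserGraph_adj_iff hk).2 hCE).ne
  have nDE := ((kneserGraph_adj_iff hk).2 hDE).ne
  rcases extra with _ | v
  · refine ⟨[B, C, D, E], ?_, ?_, ?_, rfl, rfl⟩
    · simp [nBC, nBD, nBE, nCD, nCE, nDE]
    · simp
    · simp [kneserGraph_adj_iff hk, hBC, hCD, hDE]
  · obtain ⟨hv, nB, nC, nD, nE⟩ := hextra v rfl
    -- `v` misses two of `C`, `D`, `E` and is placed between them, keeping `E` last.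
    have hcases : (Disjoint v.1 C.1 ∧ Disjoint v.1 D.1) ∨ (Disjoint v.1 C.1 ∧ Disjoint v.1 E.1) ∨
        (Disjoint v.1 D.1 ∧ Disjoint v.1 E.1) := by
      have h1 := disjoint_or_disjoint_of_card_sdiff_le_one hv hBC hBD hCD
      have h2 := disjoint_or_disjoint_of_card_sdiff_le_one hv hBC hBE hCE
      have h3 := disjoint_or_disjoint_of_card_sdiff_le_one hv hBD hBE hDE
      clear * - h1 h2 h3
      tauto
    rcases hcases with ⟨h, h'⟩ | ⟨h, h'⟩ | ⟨h, h'⟩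
    · refine ⟨[B, C, v, D, E], ?_, fun x => ?_, ?_, rfl, rfl⟩
      · simp [nBC, nBD, nBE, nCD, nCE, nDE, nB.symm, nC.symm, nD, nE]
      · simp only [List.mem_cons, List.not_mem_nil, Option.mem_some, eq_comm (a := v)]
        clear * -
        tauto
      · simp [kneserGraph_adj_iff hk, hBC, h.symm, h', hDE]
    · refine ⟨[B, D, C, v, E], ?_, fun x => ?_, ?_, rfl, rfl⟩
      · simp [nBC, nBD, nBE, nCD.symm, nCE, nDE, nB.symm, nC.symm, nD.symm, nE]
      · simp only [List.mem_cons, List.not_mem_nil, Option.mem_some, eq_comm (a := v)]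
        clear * -
        tauto
      · simp [kneserGraph_adj_iff hk, hBD, hCD.symm, h.symm, h']
    · refine ⟨[B, C, D, v, E], ?_, fun x => ?_, ?_, rfl, rfl⟩
      · simp [nBC, nBD, nBE, nCD, nCE, nDE, nB.symm, nC.symm, nD.symm, nE]
      · simp only [List.mem_cons, List.not_mem_nil, Option.mem_some, eq_comm (a := v)]
        clear * -
        tauto
      · simp [kneserGraph_adj_iff hk, hBC, hCD, h.symm, h']

/-- If `T` has at most two elements outside `B`, a quadruple of disjoint sets, possibly with an extra
set, can be traversed from `B` to a set disjoint from `T`. -/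
theorem exists_list_through_quadruple {n k : ℕ} (hk : 1 ≤ k)
    (B C D E T : {s : Finset (Fin n) // s.card = k}) (hBC : Disjoint B.1 C.1)
    (hBD : Disjoint B.1 D.1) (hBE : Disjoint B.1 E.1) (hCD : Disjoint C.1 D.1)
    (hCE : Disjoint C.1 E.1) (hDE : Disjoint D.1 E.1) (hT : (T.1 \ B.1).card ≤ 2)
    (extra : Option {s : Finset (Fin n) // s.card = k})
    (hextra : ∀ v ∈ extra, (v.1 \ B.1).card ≤ 1 ∧ v ≠ B ∧ v ≠ C ∧ v ≠ D ∧ v ≠ E) :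
    ∃ l : List {s : Finset (Fin n) // s.card = k}, l.Nodup ∧
      (∀ x, x ∈ l ↔ (x = B ∨ x = C ∨ x = D ∨ x = E) ∨ x ∈ extra) ∧
      l.IsChain (kneserGraph n k).Adj ∧ l.head? = some B ∧
      ∀ x ∈ l.getLast?, (kneserGraph n k).Adj x T := by
  have hlast : ∀ (l : List {s : Finset (Fin n) // s.card = k}) (F), Disjoint F.1 T.1 →
      l.getLast? = some F → ∀ x ∈ l.getLast?, (kneserGraph n k).Adj x T := by
    intro l F hF hl x hx
    rw [hl, Option.mem_some] at hx
    exact hx ▸ (kneserGraph_adj_iff hk).2 hF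
  rcases exists_disjoint_of_card_sdiff_le_two hT hBC hBD hBE hCD hCE hDE with h | h | h
  · obtain ⟨l, h1, h2, h3, h4, h5⟩ := exists_list_through_quadruple_ending_at hk B E D C hBE hBD
      hBC hDE.symm hCE.symm hCD.symm extra fun v hv =>
        let ⟨a, b, c, d, e⟩ := hextra v hv
        ⟨a, b, e, d, c⟩
    refine ⟨l, h1, fun x => (h2 x).trans ?_, h3, h4, hlast l C h h5⟩
    clear * -
    tauto
  · obtain ⟨l, h1, h2, h3, h4, h5⟩ := exists_list_through_quadruple_ending_at hk B C E D hBC hBE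
      hBD hCE hCD hDE.symm extra fun v hv =>
        let ⟨a, b, c, d, e⟩ := hextra v hv
        ⟨a, b, c, e, d⟩
    refine ⟨l, h1, fun x => (h2 x).trans ?_, h3, h4, hlast l D h h5⟩
    clear * -
    tauto
  · obtain ⟨l, h1, h2, h3, h4, h5⟩ := exists_list_through_quadruple_ending_at hk B C D E hBC hBD
      hBE hCD hCE hDE extra hextra
    exact ⟨l, h1, h2, h3, h4, hlast l E h h5⟩

/-! ### The Hamiltonian cycle -/

/-- For `n ≥ 4k` the `k`-subsets of `Fin n` split into quadruples `c j` of pairwise disjoint sets and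
at most three further sets `r t`, also pairwise disjoint. -/
theorem exists_partition_into_quadruples {n k : ℕ} (hn : 4 * k ≤ n) :
    ∃ (N e : ℕ) (c : Fin N → Fin 4 → {s : Finset (Fin n) // s.card = k})
      (r : Fin e → {s : Finset (Fin n) // s.card = k}), e ≤ 3 ∧
      (∀ j i i', i ≠ i' → Disjoint (c j i).1 (c j i').1) ∧
      (∀ t t', t ≠ t' → Disjoint (r t).1 (r t').1) ∧
      (∀ j i j' i', c j i = c j' i' → j = j') ∧ (∀ j i t, c j i ≠ r t) ∧
      ∀ x, (∃ j i, c j i = x) ∨ ∃ t, r t = x := by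
  obtain ⟨g, g1, g2, g3, g4⟩ := exists_baranyai_partition (α := Fin n)
    (J := Option (Fin (n.choose k / 4))) k (fun o => o.elim (n.choose k % 4) fun _ => 4)
    (by
      rintro (_ | j)
      · simp only [Option.elim, Fintype.card_fin]
        have := Nat.mul_le_mul_right k (Nat.mod_lt (n.choose k) (by norm_num : 4 > 0)).le
        omega
      · simpa using hn)
    (by
      rw [Fintype.sum_option]
      simp only [Option.elim, Finset.sum_const, Finset.card_univ, Fintype.card_fin, smul_eq_mul]
      omega)
  refine ⟨n.choose k / 4, n.choose k % 4, fun j i => ⟨g ⟨some j, i⟩, g1 _⟩,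
    fun t => ⟨g ⟨none, t⟩, g1 _⟩, by omega, fun j => g4 (some j), g4 none, ?_, ?_, ?_⟩
  · intro j i j' i' h
    have := g2 (Subtype.ext_iff.1 h)
    simpa using congrArg Sigma.fst this
  · intro j i t h
    have := g2 (Subtype.ext_iff.1 h)
    simpa using congrArg Sigma.fst this
  · rintro ⟨x, hx⟩
    obtain ⟨⟨_ | j, i⟩, h⟩ := g3 x hx
    · exact Or.inr ⟨i, Subtype.ext h⟩
    · exact Or.inl ⟨j, i, Subtype.ext h⟩

theorem kneserGraph_one_isHamiltonian {n : ℕ} (hn : 3 ≤ n) : (kneserGraph n 1).IsHamiltonian := by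
  have hadj : ∀ x y : {s : Finset (Fin n) // s.card = 1}, x ≠ y → (kneserGraph n 1).Adj x y := by
    rintro ⟨x, hx⟩ ⟨y, hy⟩ h
    refine ⟨h, ?_⟩
    obtain ⟨a, rfl⟩ := Finset.card_eq_one.1 hx
    obtain ⟨b, rfl⟩ := Finset.card_eq_one.1 hy
    simpa using h
  have hcard : Fintype.card {s : Finset (Fin n) // s.card = 1} = n := by simp
  set l := (Finset.univ : Finset {s : Finset (Fin n) // s.card = 1}).toList with hl
  have hnd : l.Nodup := Finset.nodup_toList _
  have hlen : l.length = n := by rw [hl, Finset.length_toList, Finset.card_univ, hcard]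
  refine SimpleGraph.isHamiltonian_of_list _ l hnd (by simp [hl]) (by rwa [hcard])
    (List.Pairwise.isChain (hnd.imp fun h => hadj _ _ h)) ?_
  intro x hx y hy
  refine hadj _ _ ?_
  rintro rfl
  rw [List.getLast?_eq_getElem?, Option.mem_def, List.getElem?_eq_some_iff] at hx
  rw [List.head?_eq_getElem?, Option.mem_def, List.getElem?_eq_some_iff] at hy
  obtain ⟨h1, h2⟩ := hx
  obtain ⟨h3, h4⟩ := hy
  have := (hnd.getElem_inj_iff).1 (h2.trans h4.symm)
  omega

theorem kneserGraph_isHamiltonian_of_two_le {n k : ℕ} (hk : 2 ≤ k) (hn : 4 * k ≤ n) :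
    (kneserGraph n k).IsHamiltonian := by
  classical
  have hk1 : 1 ≤ k := by omega
  obtain ⟨N, e, c, r, he, hc, hr, hcinj, hcr, hcov⟩ := exists_partition_into_quadruples hn
  -- The leftover sets cover at most `3k < n` points.
  obtain ⟨p, hp⟩ : ∃ p : Fin n, ∀ t, p ∉ (r t).1 := by
    have h1 : (Finset.univ.biUnion fun t => (r t).1).card ≤ e * k := by
      refine Finset.card_biUnion_le.trans ?_
      simp [(r _).2]
    have h2 : e * k ≤ 3 * k := Nat.mul_le_mul_right k he
    obtain ⟨p, hp⟩ := Finset.exists_mem_notMem_of_card_lt_card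
      (s := Finset.univ.biUnion fun t => (r t).1) (t := (Finset.univ : Finset (Fin n)))
      (by rw [Finset.card_univ, Fintype.card_fin]; omega)
    exact ⟨p, by simpa using hp⟩
  have hne : ∀ x : {s : Finset (Fin n) // s.card = k}, x.1.Nonempty := fun x =>
    Finset.card_pos.1 (by rw [x.2]; omega)
  -- Start set `c j i` and removed point `y` of each quadruple, adapted to `p` if `p` is covered.
  have hrep : ∀ j, ∃ (i : Fin 4) (y : Fin n), y ∈ (c j i).1 ∧ p ∉ (c j i).1.erase y ∧
      ∀ i', p ∈ (c j i').1 → i' = i ∧ y = p := by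
    intro j
    by_cases h : ∃ i, p ∈ (c j i).1
    · obtain ⟨i, hi⟩ := h
      refine ⟨i, p, hi, Finset.notMem_erase _ _, fun i' hi' => ⟨?_, rfl⟩⟩
      by_contra hii
      exact Finset.disjoint_left.1 (hc j i' i hii) hi' hi
    · push Not at h
      obtain ⟨y, hy⟩ := hne (c j 0)
      exact ⟨0, y, hy, fun h' => h 0 (Finset.mem_of_mem_erase h'), fun i' hi' => absurd hi' (h i')⟩
  choose i₀ y hy hyp huniq using hrep
  set start : Fin N → {s : Finset (Fin n) // s.card = k} := fun j => c j (i₀ j) with hstart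
  set host : Fin N → Finset (Fin n) := fun j => (start j).1.erase (y j) with hhost
  have hhostmem : ∀ j, host j ∈ Finset.powersetCard (k - 1) (Finset.univ.erase p) := fun j => by
    rw [Finset.mem_powersetCard, Finset.card_erase_of_mem (hy j), (start j).2]
    exact ⟨fun x hx => Finset.mem_erase.2 ⟨fun h => hyp j (h ▸ hx), Finset.mem_univ _⟩, rfl⟩
  have hhostsurj : ∀ S ∈ Finset.powersetCard (k - 1) (Finset.univ.erase p), ∃ j, host j = S := by
    intro S hS
    obtain ⟨hSp, hSc⟩ := Finset.mem_powersetCard.1 hS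
    have hpS : p ∉ S := fun h => Finset.notMem_erase _ _ (hSp h)
    have hcard : (insert p S).card = k := by
      rw [Finset.card_insert_of_notMem hpS, hSc]; omega
    rcases hcov ⟨insert p S, hcard⟩ with ⟨j, i, h⟩ | ⟨t, h⟩
    · have hpi : p ∈ (c j i).1 := by rw [h]; exact Finset.mem_insert_self _ _
      obtain ⟨rfl, h2⟩ := huniq j i hpi
      refine ⟨j, ?_⟩
      simp only [hhost, hstart, h, h2]
      exact Finset.erase_insert hpS
    · exact absurd (by rw [h]; exact Finset.mem_insert_self _ _) (hp t)
  -- The quadruple `h t` that takes the leftover set `r t`.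
  have hleft : ∀ t, ∃ j z, z ∈ (r t).1 ∧ host j = (r t).1.erase z := by
    intro t
    obtain ⟨z, hz⟩ := hne (r t)
    obtain ⟨j, hj⟩ := hhostsurj ((r t).1.erase z) (by
      rw [Finset.mem_powersetCard, Finset.card_erase_of_mem hz, (r t).2]
      exact ⟨fun x hx => Finset.mem_erase.2
        ⟨fun h => hp t (h ▸ Finset.mem_of_mem_erase hx), Finset.mem_univ _⟩, rfl⟩)
    exact ⟨j, z, hz, hj⟩
  choose h z hz hhz using hleft
  -- Disjoint leftover sets cannot share a host, as `k - 1 ≥ 1`.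
  have hinj : Function.Injective h := by
    intro t t' htt
    by_contra hne'
    have h1 : host (h t) ⊆ (r t).1 := by rw [hhz]; exact Finset.erase_subset _ _
    have h2 : host (h t) ⊆ (r t').1 := by rw [htt, hhz]; exact Finset.erase_subset _ _
    have h3 := (Finset.mem_powersetCard.1 (hhostmem (h t))).2
    have h4 : host (h t) = ∅ := Finset.eq_empty_of_forall_notMem fun x hx =>
      Finset.disjoint_left.1 (hr t t' hne') (h1 hx) (h2 hx)
    rw [h4, Finset.card_empty] at h3
    omega
  -- `own x` is the quadruple into whose traversal the vertex `x` goes.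
  have hown : ∀ x, ∃ j, (∀ j' i, c j' i = x → j' = j) ∧ ∀ t, r t = x → h t = j := by
    intro x
    rcases hcov x with ⟨j, i, rfl⟩ | ⟨t, rfl⟩
    · exact ⟨j, fun j' i' hj => hcinj _ _ _ _ hj, fun t ht => absurd ht.symm (hcr _ _ _)⟩
    · refine ⟨h t, fun j' i' hj => absurd hj (hcr _ _ _), fun t' ht => ?_⟩
      by_contra hne'
      have := hr t' t fun h' => hne' (congrArg h h')
      exact ((kneserGraph_adj_iff hk1).2 this).ne ht
  choose own hown1 hown2 using hown
  have hownmem : ∀ x j, own x = j ↔ (∃ i, c j i = x) ∨ ∃ t, h t = j ∧ r t = x := by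
    intro x j
    constructor
    · rintro rfl
      rcases hcov x with ⟨j, i, hx⟩ | ⟨t, hx⟩
      · exact Or.inl ⟨i, hown1 x j i hx ▸ hx⟩
      · exact Or.inr ⟨t, hown2 x t hx, hx⟩
    · rintro (⟨i, hx⟩ | ⟨t, ht, hx⟩)
      · exact (hown1 x j i hx).symm
      · rw [← ht, hown2 x t hx]
  have hpath : ∀ j j', ((start j').1 \ (start j).1).card ≤ 2 →
      ∃ l : List {s : Finset (Fin n) // s.card = k}, l.Nodup ∧ (∀ x, x ∈ l ↔ own x = j) ∧
        l.IsChain (kneserGraph n k).Adj ∧ l.head? = some (start j) ∧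
        ∀ x ∈ l.getLast?, (kneserGraph n k).Adj x (start j') := by
    intro j j' hjj
    obtain ⟨extra, hextra⟩ : ∃ o : Option {s : Finset (Fin n) // s.card = k},
        ∀ x, x ∈ o ↔ ∃ t, h t = j ∧ r t = x := by
      by_cases ht : ∃ t, h t = j
      · obtain ⟨t, rfl⟩ := ht
        refine ⟨some (r t), fun x => ⟨fun hx => ⟨t, rfl, by simpa using hx⟩, ?_⟩⟩
        rintro ⟨t', ht', rfl⟩
        rw [hinj ht']; rfl
      · refine ⟨none, fun x => ⟨fun hx => by simp at hx, ?_⟩⟩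
        rintro ⟨t', ht', rfl⟩
        exact absurd ⟨t', ht'⟩ ht
    have hd : ∀ i : Fin 4, i ≠ i + 1 ∧ i ≠ i + 2 ∧ i ≠ i + 3 ∧ i + 1 ≠ i + 2 ∧ i + 1 ≠ i + 3 ∧
        i + 2 ≠ i + 3 := by decide
    have hall : ∀ i i' : Fin 4, i' = i ∨ i' = i + 1 ∨ i' = i + 2 ∨ i' = i + 3 := by decide
    obtain ⟨d1, d2, d3, d4, d5, d6⟩ := hd (i₀ j)
    obtain ⟨l, h1, h2, h3⟩ := exists_list_through_quadruple hk1 (start j) (c j (i₀ j + 1))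
      (c j (i₀ j + 2)) (c j (i₀ j + 3)) (start j') (hc _ _ _ d1) (hc _ _ _ d2) (hc _ _ _ d3)
      (hc _ _ _ d4) (hc _ _ _ d5) (hc _ _ _ d6) hjj extra (by
        intro v hv
        obtain ⟨t, rfl, rfl⟩ := (hextra v).1 hv
        refine ⟨?_, (hcr _ _ _).symm, (hcr _ _ _).symm, (hcr _ _ _).symm, (hcr _ _ _).symm⟩
        refine (Finset.card_le_card (t := {z t}) fun x hx => ?_).trans (Finset.card_singleton _).le
        obtain ⟨hx1, hx2⟩ := Finset.mem_sdiff.1 hx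
        rw [Finset.mem_singleton]
        by_contra hxz
        have : x ∈ host (h t) := by rw [hhz]; exact Finset.mem_erase.2 ⟨hxz, hx1⟩
        exact hx2 (Finset.mem_of_mem_erase this))
    refine ⟨l, h1, fun x => ?_, h3⟩
    rw [h2, hownmem, hextra]
    refine or_congr_left ⟨?_, ?_⟩
    · rintro (rfl | rfl | rfl | rfl) <;> exact ⟨_, rfl⟩
    · rintro ⟨i, rfl⟩
      rcases hall (i₀ j) i with rfl | rfl | rfl | rfl <;> simp [hstart]
  have hnear : ∀ j j', (host j' \ host j).card ≤ 1 → ((start j').1 \ (start j).1).card ≤ 2 := by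
    intro j j' hjj
    have h1 : (start j').1 \ (start j).1 ⊆ insert (y j') (host j' \ host j) := by
      intro x hx
      obtain ⟨hx1, hx2⟩ := Finset.mem_sdiff.1 hx
      rw [Finset.mem_insert, Finset.mem_sdiff]
      by_cases hxy : x = y j'
      · exact Or.inl hxy
      · exact Or.inr ⟨Finset.mem_erase.2 ⟨hxy, hx1⟩, fun h' => hx2 (Finset.mem_of_mem_erase h')⟩
    exact (Finset.card_le_card h1).trans ((Finset.card_insert_le _ _).trans (by omega))
  have : Nonempty (Fin n) := ⟨p⟩
  obtain ⟨L, hLn, hLm, hLc, hLl⟩ := exists_cyclic_exchange_list (Finset.univ.erase p) (k - 1) (by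
    rw [Finset.card_erase_of_mem (Finset.mem_univ _), Finset.card_univ, Fintype.card_fin]; omega)
  obtain ⟨js, hjn, hjm, hjc, hjl⟩ : ∃ js : List (Fin N), js.Nodup ∧ (∀ j, j ∈ js) ∧
      js.IsChain (fun j j' => (host j' \ host j).card ≤ 1) ∧
      ∀ j ∈ js.getLast?, ∀ j' ∈ js.head?, (host j' \ host j).card ≤ 1 := by
    have hmem : ∀ j, host j ∈ L := fun j => (hLm _).2 (hhostmem j)
    obtain ⟨js, j1, j2, j3, j4, j5⟩ := exists_list_refining host ExchangeClose
      (fun S => by simp [ExchangeClose]) L hLn hLc fun S hS => hhostsurj S ((hLm S).1 hS)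
    refine ⟨js, j1, fun j => (j2 j).2 (hmem j), j3.imp fun _ _ h => h.2, fun j hj j' hj' => ?_⟩
    refine (hLl (host j) ?_ (host j') ?_).2
    · rw [← j5, Option.mem_def.1 hj]; rfl
    · rw [← j4, Option.mem_def.1 hj']; rfl
  rcases js with _ | ⟨j, js⟩
  · obtain ⟨S, hS⟩ := Finset.powersetCard_nonempty.2 (show k - 1 ≤ (Finset.univ.erase p).card by
      rw [Finset.card_erase_of_mem (Finset.mem_univ _), Finset.card_univ, Fintype.card_fin]; omega)
    obtain ⟨j, -⟩ := hhostsurj S hS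
    exact absurd (hjm j) (by simp)
  obtain ⟨l, h1, h2, h3, h4, h5⟩ := exists_list_through_blocks (kneserGraph n k) own start
    (fun j j' => ((start j').1 \ (start j).1).card ≤ 2) hpath js j j hjn
    (hjc.imp fun j j' => hnear j j') fun i hi => hnear i j (hjl i hi j rfl)
  refine SimpleGraph.isHamiltonian_of_list _ l h1 (fun v => (h2 v).2 (hjm _)) ?_ h3 ?_
  · have hcj : Function.Injective (c j) := fun i i' hii => by
      by_contra hne'
      exact ((kneserGraph_adj_iff hk1).2 (hc j i i' hne')).ne hii
    have := Fintype.card_le_of_injective _ hcj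
    rw [Fintype.card_fin] at this
    omega
  · rw [h4]
    rintro x hx y hy
    obtain rfl : start j = y := by simpa using hy
    exact h5 x hx

theorem theorem2 (n k : ℕ) (hk : 1 ≤ k) (hn : 4 * k ≤ n) :
    (kneserGraph n k).IsHamiltonian := by
  rcases hk.eq_or_lt with rfl | hk2
  · exact kneserGraph_one_isHamiltonian (by omega)
  · exact kneserGraph_isHamiltonian_of_two_le hk2 hn
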